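/- For $p,q>0$, $x\ge 0$ and $0\le y\le 1$ let $$B_{p,q}(x,y)=e^{-x/2}\sum_{j=0}^{\infty}\frac{1}{j!}\Bigl(\frac x2\Bigr)^j I_y(p+j,q),\qquad I_y(p,q)=\frac{\Gamma(p+q)}{\Gamma(p)\Gamma(q)}\int_0^y t^{p-1}(1-t)^{q-1}\,dt,$$ be the cumulative noncentral beta distribution function. Put $z=\tfrac12xy$, let $(a)_n=a(a+1)\cdots(a+n-1)$, $(a)_0=1$, and for $n\ge 0$ and $0<y<1$ set $$a_n=(-1)^n\frac{(1-p-q)_n}{n!},\qquad b_n=\Bigl(\frac{y}{1-y}\Bigr)^n,\qquad c_n=\sum_{m=0}^n a_m b_{n-m}.$$ Then $$B_{p,q}(x,y)\sim \frac{e^{-(1-y)x/2}\,y^p(1-y)^{q-1}z^{q-1}}{\Gamma(q)}\sum_{n=0}^\infty(-1)^n(1-q)_n\frac{c_n}{z^n},\qquad z\to\infty,$$ uniformly for $0<y\le 1-\delta$ with fixed $\delta>0$ and for $p,q>0$ bounded with $p+q$ bounded away from $0$. That is, for all $R,\varepsilon,\delta>0$ and every integer $N\ge 0$ there are constants $C,Z>0$,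 depending only on $R,\varepsilon,\delta,N$, such that $$\Bigl|B_{p,q}(x,y)-P\sum_{n=0}^{N-1}(-1)^n(1-q)_n\frac{c_n}{z^n}\Bigr|\le \frac{C\,P}{z^{N}},\qquad P=\frac{e^{-(1-y)x/2}y^p(1-y)^{q-1}z^{q-1}}{\Gamma(q)},$$ whenever $0<p\le R$, $0<q\le R$, $p+q\ge\varepsilon$, $0<y\le 1-\delta$ and $z\ge Z$. Moreover, the expansion is finite and exact when $q$ is a positive integer: for all $p>0$, $x>0$, $0<y<1$ and every integer $q\ge 1$, the terms with $n\ge q$ vanish and $$B_{p,q}(x,y)=\frac{e^{-(1-y)x/2}\,y^p(1-y)^{q-1}z^{q-1}}{\Gamma(q)}\sum_{n=0}^{q-1}(-1)^n(1-q)_n\frac{c_n}{z^n}.$$ -/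

import Mathlib

noncomputable section

/-- The central beta distribution function `I_y(p,q)` (regularized incomplete beta function);
`ProbabilityTheory.beta p q = Γ(p) Γ(q) / Γ(p+q)`. -/
def centralBetaCDF (p q y : ℝ) : ℝ :=
  1 / ProbabilityTheory.beta p q * ∫ t in (0 : ℝ)..y, t ^ (p - 1) * (1 - t) ^ (q - 1)

/-- The cumulative noncentral beta distribution function `B_{p,q}(x,y)`. -/
def noncentralBetaCDF (p q x y : ℝ) : ℝ :=
  Real.exp (-x / 2) *
    ∑' j : ℕ, 1 / (j.factorial : ℝ) * (x / 2) ^ j * centralBetaCDF (p + j) q y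

/-- The Pochhammer symbol `(a)_n = a (a+1) ⋯ (a+n-1)`. -/
def pochhammerSymbol (a : ℝ) (n : ℕ) : ℝ := (ascPochhammer ℝ n).eval a

/-- `a_n = (-1)^n (1-p-q)_n / n!`, the Taylor coefficients of `t^(p+q-1)` at `t = 1`. -/
def coeffA (p q : ℝ) (n : ℕ) : ℝ :=
  (-1) ^ n * pochhammerSymbol (1 - p - q) n / (n.factorial : ℝ)

/-- `b_n = (y/(1-y))^n`, the Taylor coefficients of `(1-y)/(1-yt)` at `t = 1`. -/
def coeffB (y : ℝ) (n : ℕ) : ℝ := (y / (1 - y)) ^ n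

/-- `c_n = ∑_{m=0}^n a_m b_{n-m}`. -/
def coeffC (p q y : ℝ) (n : ℕ) : ℝ :=
  ∑ m ∈ Finset.range (n + 1), coeffA p q m * coeffB y (n - m)

/-- The factor `e^{-(1-y)x/2} y^p (1-y)^{q-1} z^{q-1} / Γ(q)` with `z = xy/2`. -/
def largeZPrefactor (p q x y : ℝ) : ℝ :=
  Real.exp (-(1 - y) * x / 2) * y ^ p * (1 - y) ^ (q - 1) * (x * y / 2) ^ (q - 1) /
    Real.Gamma q

/-- The `n`-th term `(-1)^n (1-q)_n c_n / z^n` with `z = xy/2`. -/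
def largeZTerm (p q x y : ℝ) (n : ℕ) : ℝ :=
  (-1) ^ n * pochhammerSymbol (1 - q) n * (coeffC p q y n / (x * y / 2) ^ n)

end

/-!
The identity `I_y(a, q) - I_y(a + 1, q) = y^a (1 - y)^q Γ(a + q) / (Γ(q) Γ(a + 1))` turns
`B_{p,q}(x, y) - B_{p+1,q}(x, y)` into an elementary factor times a Kummer function of
`z = xy/2`. Telescoping in `p` gives `B_{p,q}(x, y)` as a power series in `y` whose `m`-th
coefficient is the Kummer function with parameters `a = p + q + m` and `b = p + m + 1`.

Watson's lemma for Euler's integral gives the large-`z` expansion of these functions when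
`a ≤ b`, that is `q ≤ 1`, with an error at most polynomial in `a`. A contiguous relation extends
the bound from `q` to `q + 1`; starting from `q = 1`, where the Kummer function is `1`, it also
shows that the expansion is finite and exact for integers `q`. The error bounds are summable
against `y^m`, and the main terms add up to the `c_n` because
`∑_m binom(p + q - 1 + m, n) y^m = c_n / (1 - y)`.
-/

open MeasureTheory Filter Topology

/-! ### Pochhammer symbols and generalized binomial coefficients -/

theorem pochhammerSymbol_zero (u : ℝ) : pochhammerSymbol u 0 = 1 := by
  simp [pochhammerSymbol]

theorem pochhammerSymbol_succ (u : ℝ) (n : ℕ) :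
    pochhammerSymbol u (n + 1) = pochhammerSymbol u n * (u + n) :=
  ascPochhammer_succ_eval n u

theorem pochhammerSymbol_succ_left (u : ℝ) (n : ℕ) :
    pochhammerSymbol u (n + 1) = u * pochhammerSymbol (u + 1) n := by
  simp [pochhammerSymbol, ascPochhammer_succ_left]

theorem pochhammerSymbol_one_sub_natCast_of_le {k n : ℕ} (hk : 1 ≤ k) (hkn : k ≤ n) :
    pochhammerSymbol (1 - k) n = 0 := by
  have := ascPochhammer_eval_neg_coe_nat_of_lt (R := ℝ) (n := n) (k := k - 1) (by lia)
  rwa [Nat.cast_sub hk, Nat.cast_one, neg_sub] at this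

theorem pochhammerSymbol_nonneg {u : ℝ} (hu : 0 ≤ u) (n : ℕ) : 0 ≤ pochhammerSymbol u n := by
  induction n with
  | zero => simp [pochhammerSymbol_zero]
  | succ n ih => rw [pochhammerSymbol_succ]; positivity

theorem pochhammerSymbol_le_factorial {u : ℝ} (hu : 0 ≤ u) (hu1 : u ≤ 1) (n : ℕ) :
    pochhammerSymbol u n ≤ n.factorial := by
  induction n with
  | zero => simp [pochhammerSymbol_zero]
  | succ n ih =>
    have := pochhammerSymbol_nonneg hu n
    rw [pochhammerSymbol_succ, Nat.factorial_succ, mul_comm (n + 1), Nat.cast_mul, Nat.cast_succ]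
    exact mul_le_mul ih (by linarith) (by positivity) (by positivity)

theorem Gamma_add_natCast {u : ℝ} (hu : 0 < u) (n : ℕ) :
    Real.Gamma (u + n) = pochhammerSymbol u n * Real.Gamma u := by
  induction n with
  | zero => simp [pochhammerSymbol_zero]
  | succ n ih =>
    rw [Nat.cast_succ, ← add_assoc, Real.Gamma_add_one (by positivity), ih, pochhammerSymbol_succ]
    ring

theorem succ_mul_ringChoose_succ (r : ℝ) (n : ℕ) :
    (n + 1) * Ring.choose r (n + 1) = r * Ring.choose (r - 1) n := by
  simpa [Ring.choose_one_right] using Ring.choose_smul_choose r (Nat.le_add_left 1 n)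

theorem succ_mul_ringChoose_succ_right (r : ℝ) (n : ℕ) :
    (n + 1) * Ring.choose r (n + 1) = (r - n) * Ring.choose r n := by
  simpa [Ring.choose_one_right, mul_comm] using Ring.choose_smul_choose r (Nat.le_succ n)

theorem abs_ringChoose_le (r : ℝ) (n : ℕ) : |Ring.choose r n| ≤ (1 + |r|) ^ n := by
  induction n with
  | zero => simp
  | succ n ih =>
    have hfactor : |r - n| ≤ (n + 1) * (1 + |r|) := by
      have := abs_sub r n
      rw [Nat.abs_cast] at this
      nlinarith [abs_nonneg r, n.cast_nonneg (α := ℝ)]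
    have hsucc := congrArg abs (succ_mul_ringChoose_succ_right r n)
    rw [abs_mul, abs_mul, abs_of_pos (by positivity : (0 : ℝ) < n + 1)] at hsucc
    refine le_of_mul_le_mul_left ?_ (by positivity : (0 : ℝ) < n + 1)
    calc (n + 1) * |Ring.choose r (n + 1)| = |r - n| * |Ring.choose r n| := hsucc
      _ ≤ (n + 1) * (1 + |r|) * (1 + |r|) ^ n := by gcongr
      _ = (n + 1) * (1 + |r|) ^ (n + 1) := by ring

theorem coeffA_eq_ringChoose (p q : ℝ) (n : ℕ) :
    coeffA p q n = Ring.choose (p + q - 1) n := by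
  have hfact : (n.factorial : ℝ) ≠ 0 := by positivity
  have hdesc := Ring.descPochhammer_eq_factorial_smul_choose (p + q - 1) n
  rw [coeffA, pochhammerSymbol, show 1 - p - q = -(p + q - 1) by ring,
    ascPochhammer_eval_neg_eq_descPochhammer, ← mul_assoc, ← mul_pow, neg_one_mul, neg_neg,
    one_pow, one_mul, div_eq_iff hfact, mul_comm, ← nsmul_eq_mul, ← hdesc,
    Polynomial.descPochhammer_smeval_eq_ascPochhammer, descPochhammer_eval_eq_ascPochhammer,
    Polynomial.ascPochhammer_smeval_eq_eval]

theorem hasSum_pow_mul_natChoose {y : ℝ} (hy : |y| < 1) (k : ℕ) :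
    HasSum (fun m : ℕ => y ^ m * (m.choose k : ℝ)) (y ^ k / (1 - y) ^ (k + 1)) := by
  have hvanish (m : ℕ) (hm : m ∈ Finset.range k) : y ^ m * (m.choose k : ℝ) = 0 := by
    rw [Nat.choose_eq_zero_of_lt (Finset.mem_range.mp hm), Nat.cast_zero, mul_zero]
  rw [← hasSum_nat_add_iff' k, Finset.sum_eq_zero hvanish, sub_zero, ← mul_one_div]
  exact ((hasSum_choose_mul_geometric_of_norm_lt_one k hy).mul_left (y ^ k)).congr_fun
    fun m => by ring

/- The Chu–Vandermonde identity separates `m` from `p + q - 1`. -/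
theorem hasSum_pow_mul_ringChoose (p q : ℝ) {y : ℝ} (hy : |y| < 1) (n : ℕ) :
    HasSum (fun m : ℕ => y ^ m * Ring.choose (p + q - 1 + m) n) (coeffC p q y n / (1 - y)) := by
  have hy1 : 1 - y ≠ 0 := by linarith [(abs_lt.mp hy).2]
  have hvandermonde := hasSum_sum (s := Finset.range (n + 1)) fun i _ =>
    (hasSum_pow_mul_natChoose hy (n - i)).mul_left (Ring.choose (p + q - 1) i)
  convert! hvandermonde using 1
  · funext m
    rw [Ring.add_choose_eq n (Commute.all _ _),
      Finset.Nat.sum_antidiagonal_eq_sum_range_succ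
        (fun i j => Ring.choose (p + q - 1) i * Ring.choose (m : ℝ) j), Finset.mul_sum]
    refine Finset.sum_congr rfl fun i _ => ?_
    rw [Ring.choose_natCast]
    ring
  · rw [coeffC, Finset.sum_div]
    refine Finset.sum_congr rfl fun i _ => ?_
    rw [coeffA_eq_ringChoose, coeffB, div_pow, pow_succ]
    field_simp

/-! ### Kummer functions -/

theorem tendsto_add_natCast_div_add_natCast (a b : ℝ) :
    Tendsto (fun n : ℕ => (a + n) / (b + n)) atTop (𝓝 1) := by
  simpa using tendsto_add_mul_div_add_mul_atTop_nhds a b 1 (one_ne_zero (α := ℝ))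

/-- The terms of `Γ(a)/Γ(b) · ₁F₁(a; b; z)`. -/
noncomputable def kummerTerm (a b z : ℝ) (j : ℕ) : ℝ :=
  z ^ j / j.factorial * (Real.Gamma (a + j) / Real.Gamma (b + j))

/-- The Kummer function `e^{-z} Γ(a)/Γ(b) · ₁F₁(a; b; z)`, normalized so that it is
asymptotic to `z^{a-b}` as `z → ∞`. -/
noncomputable def scaledKummer (a b z : ℝ) : ℝ := Real.exp (-z) * ∑' j, kummerTerm a b z j

theorem kummerTerm_succ {a b : ℝ} (z : ℝ) {j : ℕ} (ha : 0 < a + j) (hb : 0 < b + j) :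
    kummerTerm a b z (j + 1) = z / (j + 1) * ((a + j) / (b + j)) * kummerTerm a b z j := by
  rw [kummerTerm, kummerTerm, Nat.factorial_succ, Nat.cast_mul, Nat.cast_succ, ← add_assoc,
    ← add_assoc, Real.Gamma_add_one ha.ne', Real.Gamma_add_one hb.ne', pow_succ,
    mul_div_mul_comm, mul_div_mul_comm]
  ring

theorem summable_kummerTerm (a b z : ℝ) : Summable (kummerTerm a b z) := by
  have hratio : Tendsto (fun j : ℕ => z / (j + 1) * ((a + j) / (b + j))) atTop (𝓝 0) := by
    simpa using (tendsto_const_div_atTop_nhds_zero_nat z |>.comp (tendsto_add_atTop_nat 1)).mul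
      (tendsto_add_natCast_div_add_natCast a b)
  have hpos (u : ℝ) : ∀ᶠ j : ℕ in atTop, 0 < u + j :=
    (tendsto_atTop_add_const_left _ u tendsto_natCast_atTop_atTop).eventually_gt_atTop 0
  refine summable_of_ratio_norm_eventually_le (r := 1 / 2) (by norm_num) ?_
  filter_upwards [hpos a, hpos b, hratio.norm.eventually_le_const (by norm_num : ‖(0 : ℝ)‖ < 1 / 2)]
    with j ha hb hj
  rw [kummerTerm_succ z ha hb, norm_mul]
  gcongr

theorem kummerTerm_nonneg {a b z : ℝ} (ha : 0 ≤ a) (hb : 0 ≤ b) (hz : 0 ≤ z) (j : ℕ) :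
    0 ≤ kummerTerm a b z j :=
  mul_nonneg (by positivity) (div_nonneg (Real.Gamma_nonneg_of_nonneg (by positivity))
    (Real.Gamma_nonneg_of_nonneg (by positivity)))

theorem scaledKummer_nonneg {a b z : ℝ} (ha : 0 ≤ a) (hb : 0 ≤ b) (hz : 0 ≤ z) :
    0 ≤ scaledKummer a b z :=
  mul_nonneg (Real.exp_pos _).le (tsum_nonneg (kummerTerm_nonneg ha hb hz))

theorem natCast_mul_kummerTerm_succ (a b z : ℝ) (j : ℕ) :
    ((j + 1 : ℕ) : ℝ) * kummerTerm a b z (j + 1) = z * kummerTerm (a + 1) (b + 1) z j := by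
  rw [kummerTerm, kummerTerm, Nat.factorial_succ, Nat.cast_mul, Nat.cast_succ, pow_succ',
    add_right_comm a, add_right_comm b, add_assoc a, add_assoc b]
  field_simp

theorem kummerTerm_add_one {a : ℝ} (ha : 0 < a) (b z : ℝ) (j : ℕ) :
    kummerTerm (a + 1) b z j = (a + j) * kummerTerm a b z j := by
  rw [kummerTerm, kummerTerm, add_right_comm, Real.Gamma_add_one (by positivity)]
  ring

/- Of the two summands of `Γ(a + 1 + j) = (a + j) Γ(a + j)`, the one with the factor `j` cancels
part of `j!` and gives the shifted series. -/
theorem scaledKummer_add_one {a : ℝ} (ha : 0 < a) (b z : ℝ) :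
    scaledKummer (a + 1) b z = z * scaledKummer (a + 1) (b + 1) z + a * scaledKummer a b z := by
  have hshift : HasSum (fun j : ℕ => (j : ℝ) * kummerTerm a b z j)
      (z * ∑' j, kummerTerm (a + 1) (b + 1) z j) := by
    rw [← hasSum_nat_add_iff' 1]
    simpa using ((summable_kummerTerm (a + 1) (b + 1) z).hasSum.mul_left z).congr_fun
      (natCast_mul_kummerTerm_succ a b z)
  have hsum := hshift.add ((summable_kummerTerm a b z).hasSum.mul_left a)
  rw [scaledKummer, (hsum.congr_fun fun j => by rw [kummerTerm_add_one ha]; ring).tsum_eq,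
    scaledKummer, scaledKummer]
  ring

theorem hasSum_pow_div_factorial (z : ℝ) :
    HasSum (fun j : ℕ => z ^ j / (j.factorial : ℝ)) (Real.exp z) := by
  rw [Real.exp_eq_exp_ℝ]
  exact NormedSpace.expSeries_div_hasSum_exp z

theorem scaledKummer_self {a : ℝ} (ha : 0 < a) (z : ℝ) : scaledKummer a a z = 1 := by
  have hterm (j : ℕ) : kummerTerm a a z j = z ^ j / (j.factorial : ℝ) := by
    rw [kummerTerm, div_self (Real.Gamma_pos_of_pos (by positivity)).ne', mul_one]
  rw [scaledKummer, tsum_congr hterm, (hasSum_pow_div_factorial z).tsum_eq, ← Real.exp_add,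
    neg_add_cancel, Real.exp_zero]

/-- The `n`-th term of the large-`z` expansion of `scaledKummer a b z`. -/
noncomputable def kummerExpansionTerm (a b z : ℝ) (n : ℕ) : ℝ :=
  z ^ (a - b - n) * ((-1) ^ n * pochhammerSymbol (b - a) n * Ring.choose (a - 1) n)

/-- The error of the first `N` terms of the large-`z` expansion of `scaledKummer a b z`. -/
noncomputable def kummerRemainder (N : ℕ) (a b z : ℝ) : ℝ :=
  scaledKummer a b z - ∑ n ∈ Finset.range N, kummerExpansionTerm a b z n

theorem kummerExpansionTerm_zero (a b z : ℝ) : kummerExpansionTerm a b z 0 = z ^ (a - b) := by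
  simp [kummerExpansionTerm, pochhammerSymbol_zero]

theorem kummerExpansionTerm_add_one_zero {z : ℝ} (hz : z ≠ 0) (a b : ℝ) :
    kummerExpansionTerm (a + 1) b z 0 = z * kummerExpansionTerm (a + 1) (b + 1) z 0 := by
  rw [kummerExpansionTerm_zero, kummerExpansionTerm_zero, add_sub_add_right_eq_sub,
    add_sub_right_comm, Real.rpow_add_one hz, mul_comm]

theorem kummerExpansionTerm_add_one_succ {z : ℝ} (hz : z ≠ 0) (a b : ℝ) (n : ℕ) :
    kummerExpansionTerm (a + 1) b z (n + 1) =
      z * kummerExpansionTerm (a + 1) (b + 1) z (n + 1) + a * kummerExpansionTerm a b z n := by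
  have hpoch := pochhammerSymbol_succ_left (b - a - 1) n
  have hpoch' := pochhammerSymbol_succ (b - a) n
  have hchoose := succ_mul_ringChoose_succ a n
  have hpow : z ^ (a - b - n) = z * z ^ (a - b - (n + 1)) := by
    rw [mul_comm, ← Real.rpow_add_one hz]
    ring_nf
  rw [sub_add_cancel] at hpoch
  rw [kummerExpansionTerm, kummerExpansionTerm, kummerExpansionTerm, add_sub_add_right_eq_sub,
    add_sub_add_right_eq_sub, add_sub_cancel_right, Nat.cast_succ,
    show a + 1 - b - (n + 1 : ℝ) = a - b - n by ring,
    show b - (a + 1) = b - a - 1 by ring, hpoch, hpoch', hpow]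
  linear_combination z * z ^ (a - b - (n + 1)) * (-1) ^ n * pochhammerSymbol (b - a) n * hchoose

theorem kummerRemainder_zero (a b z : ℝ) : kummerRemainder 0 a b z = scaledKummer a b z := by
  simp [kummerRemainder]

/- At `N = 0` the truncated `N - 1 = 0` is the intended index: there are no terms to subtract. -/
theorem kummerRemainder_add_one (N : ℕ) {a z : ℝ} (ha : 0 < a) (hz : z ≠ 0) (b : ℝ) :
    kummerRemainder N (a + 1) b z =
      z * kummerRemainder N (a + 1) (b + 1) z + a * kummerRemainder (N - 1) a b z := by
  cases N with
  | zero => simpa only [Nat.zero_sub, kummerRemainder_zero] using scaledKummer_add_one ha b z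
  | succ N =>
    rw [kummerRemainder, kummerRemainder, kummerRemainder, scaledKummer_add_one ha,
      Finset.sum_range_succ', Finset.sum_range_succ', kummerExpansionTerm_add_one_zero hz,
      Finset.sum_congr rfl fun n _ => kummerExpansionTerm_add_one_succ hz a b n,
      Finset.sum_add_distrib, ← Finset.mul_sum, ← Finset.mul_sum, Nat.add_sub_cancel]
    ring

theorem kummerRemainder_self (N : ℕ) {a : ℝ} (ha : 0 < a) (z : ℝ) :
    kummerRemainder (N + 1) a a z = 0 := by
  have hvanish (n : ℕ) : kummerExpansionTerm a a z (n + 1) = 0 := by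
    simp [kummerExpansionTerm, pochhammerSymbol_succ_left]
  simp [kummerRemainder, scaledKummer_self ha, Finset.sum_range_succ', hvanish,
    kummerExpansionTerm_zero]

theorem kummerRemainder_sub_natCast {k N : ℕ} (hkN : k < N) {a z : ℝ} (ha : k < a) (hz : z ≠ 0) :
    kummerRemainder N a (a - k) z = 0 := by
  induction k generalizing a N with
  | zero =>
    obtain ⟨N, rfl⟩ := Nat.exists_eq_succ_of_ne_zero hkN.ne'
    simpa using kummerRemainder_self N (by simpa using ha) z
  | succ k ih =>
    push_cast at ha ⊢
    have hrec := kummerRemainder_add_one N (by linarith [k.cast_nonneg (α := ℝ)] : 0 < a - 1) hz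
      (a - (k + 1))
    rw [sub_add_cancel, show a - (k + 1 : ℝ) + 1 = a - k by ring, ih (by lia) (by linarith),
      show a - (k + 1 : ℝ) = a - 1 - k by ring, ih (by lia) (by linarith)] at hrec
    rw [show a - (k + 1 : ℝ) = a - 1 - k by ring, hrec, mul_zero, mul_zero, add_zero]

/-! ### Watson's lemma -/

theorem integrableOn_exp_neg_mul_mul_rpow {u z : ℝ} (hu : 0 < u) (hz : 0 < z) :
    IntegrableOn (fun s : ℝ => Real.exp (-(z * s)) * s ^ (u - 1)) (Set.Ioi 0) := by
  have := integrableOn_rpow_mul_exp_neg_mul_rpow (by linarith : -1 < u - 1) one_pos hz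
  simpa only [Real.rpow_one, neg_mul, mul_comm (Real.exp _)] using this

theorem integral_exp_neg_mul_mul_rpow {u z : ℝ} (hu : 0 < u) (hz : 0 < z) :
    ∫ s in Set.Ioi (0 : ℝ), Real.exp (-(z * s)) * s ^ (u - 1) = Real.Gamma u * z ^ (-u) := by
  have := Real.integral_rpow_mul_exp_neg_mul_Ioi hu hz
  rw [one_div, Real.inv_rpow hz.le, ← Real.rpow_neg hz.le] at this
  simpa only [mul_comm] using this

theorem integrableOn_exp_neg_mul_mul {g : ℝ → ℝ} {z : ℝ} (hz : 0 ≤ z)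
    (hg : IntegrableOn g (Set.Ioi 0)) :
    IntegrableOn (fun s => Real.exp (-(z * s)) * g s) (Set.Ioi 0) := by
  refine hg.bdd_mul (c := 1) (by fun_prop) ?_
  filter_upwards [ae_restrict_mem measurableSet_Ioi] with s (hs : 0 < s)
  rw [Real.norm_of_nonneg (Real.exp_pos _).le, Real.exp_le_one_iff, neg_nonpos]
  positivity

theorem eqOn_exp_neg_mul_mul_rpow_mul_sum (u z : ℝ) (c : ℕ → ℝ) (N : ℕ) :
    Set.EqOn (fun s : ℝ =>
        Real.exp (-(z * s)) * (s ^ (u - 1) * ∑ n ∈ Finset.range N, c n * s ^ n))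
      (fun s => ∑ n ∈ Finset.range N, c n * (Real.exp (-(z * s)) * s ^ (u + n - 1)))
      (Set.Ioi 0) := fun s hs => by
  simp only [Finset.mul_sum]
  refine Finset.sum_congr rfl fun n _ => ?_
  rw [add_sub_right_comm, Real.rpow_add_natCast (ne_of_gt hs)]
  ring

theorem integrableOn_exp_neg_mul_mul_rpow_mul_sum {u z : ℝ} (hu : 0 < u) (hz : 0 < z)
    (c : ℕ → ℝ) (N : ℕ) :
    IntegrableOn (fun s : ℝ =>
      Real.exp (-(z * s)) * (s ^ (u - 1) * ∑ n ∈ Finset.range N, c n * s ^ n)) (Set.Ioi 0) := by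
  rw [integrableOn_congr_fun (eqOn_exp_neg_mul_mul_rpow_mul_sum u z c N) measurableSet_Ioi]
  exact integrable_finsetSum _ fun n _ =>
    (integrableOn_exp_neg_mul_mul_rpow (by positivity) hz).const_mul _

theorem integral_exp_neg_mul_mul_rpow_mul_sum {u z : ℝ} (hu : 0 < u) (hz : 0 < z) (c : ℕ → ℝ)
    (N : ℕ) :
    ∫ s in Set.Ioi (0 : ℝ),
        Real.exp (-(z * s)) * (s ^ (u - 1) * ∑ n ∈ Finset.range N, c n * s ^ n) =
      ∑ n ∈ Finset.range N, c n * (Real.Gamma (u + n) * z ^ (-(u + n))) := by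
  rw [setIntegral_congr_fun measurableSet_Ioi (eqOn_exp_neg_mul_mul_rpow_mul_sum u z c N),
    integral_finsetSum _ fun n _ =>
      (integrableOn_exp_neg_mul_mul_rpow (by positivity) hz).const_mul _]
  refine Finset.sum_congr rfl fun n _ => ?_
  rw [integral_const_mul, integral_exp_neg_mul_mul_rpow (by positivity) hz]

/- Up to `s₀` the bound is that of the Taylor polynomial `T`; beyond it, the exponential is small
against `f`, while `T` alone still obeys the bound. -/
theorem exp_neg_mul_mul_abs_sub_le {f T z s s₀ E : ℝ} (hz : 0 ≤ z)
    (hnear : s ≤ s₀ → |f - T| ≤ E) (hfar : s₀ < s → |T| ≤ E) :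
    Real.exp (-(z * s)) * |f - T| ≤
      Real.exp (-(z * s)) * E + Real.exp (-(z * s₀)) * |f| := by
  rcases le_or_gt s s₀ with hs | hs
  · have : 0 ≤ Real.exp (-(z * s₀)) * |f| := by positivity
    linarith [mul_le_mul_of_nonneg_left (hnear hs) (Real.exp_pos (-(z * s))).le]
  · calc Real.exp (-(z * s)) * |f - T| ≤ Real.exp (-(z * s)) * (|f| + E) := by
          gcongr
          linarith [abs_sub f T, hfar hs]
      _ = Real.exp (-(z * s)) * E + Real.exp (-(z * s)) * |f| := by ring
      _ ≤ Real.exp (-(z * s)) * E + Real.exp (-(z * s₀)) * |f| := by gcongr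

theorem abs_integral_exp_neg_mul_sub_sum_le {f : ℝ → ℝ} {c : ℕ → ℝ} {u z s₀ D : ℝ} {N : ℕ}
    (hu : 0 < u) (hz : 0 < z) (hf : IntegrableOn (fun s => s ^ (u - 1) * f s) (Set.Ioi 0))
    (hnear : ∀ s, 0 < s → s ≤ s₀ → |f s - ∑ n ∈ Finset.range N, c n * s ^ n| ≤ D * s ^ N)
    (hfar : ∀ s, 0 < s → s₀ < s → |∑ n ∈ Finset.range N, c n * s ^ n| ≤ D * s ^ N) :
    |(∫ s in Set.Ioi (0 : ℝ), Real.exp (-(z * s)) * (s ^ (u - 1) * f s)) -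
        ∑ n ∈ Finset.range N, c n * (Real.Gamma (u + n) * z ^ (-(u + n)))| ≤
      D * (Real.Gamma (u + N) * z ^ (-(u + N))) +
        Real.exp (-(z * s₀)) * ∫ s in Set.Ioi (0 : ℝ), |s ^ (u - 1) * f s| := by
  have huN : 0 < u + N := by positivity
  have hpow := (integrableOn_exp_neg_mul_mul_rpow huN hz).const_mul D
  have htail := hf.abs.const_mul (Real.exp (-(z * s₀)))
  rw [← integral_exp_neg_mul_mul_rpow_mul_sum hu hz,
    ← integral_sub (integrableOn_exp_neg_mul_mul hz.le hf)
      (integrableOn_exp_neg_mul_mul_rpow_mul_sum hu hz c N),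
    ← integral_exp_neg_mul_mul_rpow huN hz, ← integral_const_mul, ← integral_const_mul,
    ← integral_add hpow htail, ← Real.norm_eq_abs]
  refine norm_integral_le_of_norm_le (hpow.add htail) ?_
  filter_upwards [ae_restrict_mem measurableSet_Ioi] with s (hs : 0 < s)
  have hsu : 0 ≤ s ^ (u - 1) := by positivity
  have hpointwise := mul_le_mul_of_nonneg_left
    (exp_neg_mul_mul_abs_sub_le hz.le (hnear s hs) (hfar s hs)) hsu
  rw [← mul_sub, ← mul_sub, norm_mul, norm_mul, Real.norm_of_nonneg (Real.exp_pos _).le,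
    Real.norm_of_nonneg hsu, Real.norm_eq_abs, abs_mul, abs_of_nonneg hsu, add_sub_right_comm,
    Real.rpow_add_natCast hs.ne']
  linarith

/-! ### Taylor remainders of the binomial series -/

/-- The remainder of the `N`-term Taylor expansion of `(1 - s) ^ r` at `s = 0`. -/
noncomputable def oneSubRpowRemainder (N : ℕ) (r s : ℝ) : ℝ :=
  (1 - s) ^ r - ∑ n ∈ Finset.range N, (-1) ^ n * Ring.choose r n * s ^ n

theorem oneSubRpowRemainder_succ_zero (N : ℕ) (r : ℝ) : oneSubRpowRemainder (N + 1) r 0 = 0 := by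
  simp [oneSubRpowRemainder, Finset.sum_range_succ']

theorem hasDerivAt_oneSubRpowRemainder_succ (N : ℕ) (r : ℝ) {s : ℝ} (hs : s < 1) :
    HasDerivAt (oneSubRpowRemainder (N + 1) r) (-r * oneSubRpowRemainder N (r - 1) s) s := by
  have hrpow := ((hasDerivAt_id s).const_sub 1).rpow_const (p := r)
    (Or.inl (sub_pos.mpr hs).ne')
  have hpoly : HasDerivAt
      (fun t : ℝ => ∑ n ∈ Finset.range N, (-1) ^ (n + 1) * Ring.choose r (n + 1) * t ^ (n + 1))
      (∑ n ∈ Finset.range N, -r * ((-1) ^ n * Ring.choose (r - 1) n * s ^ n)) s := by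
    refine HasDerivAt.fun_sum fun n _ => ?_
    refine ((hasDerivAt_pow (n + 1) s).const_mul _).congr_deriv ?_
    rw [Nat.cast_succ, Nat.add_sub_cancel]
    linear_combination (-1) ^ (n + 1) * s ^ n * succ_mul_ringChoose_succ r n
  refine ((hrpow.sub (hpoly.add_const 1)).congr_of_eventuallyEq
    (.of_forall fun t => ?_)).congr_deriv ?_
  · simp [oneSubRpowRemainder, Finset.sum_range_succ']
  · rw [← Finset.mul_sum, oneSubRpowRemainder, id]
    ring

theorem one_sub_rpow_le_two_pow {r s : ℝ} {K : ℕ} (hr : -(K : ℝ) ≤ r) (hs : 0 ≤ s)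
    (hs2 : s ≤ 1 / 2) : (1 - s) ^ r ≤ 2 ^ K :=
  calc (1 - s) ^ r ≤ (1 - s) ^ (-(K : ℝ)) :=
        Real.rpow_le_rpow_of_exponent_ge (by linarith) (by linarith) hr
    _ ≤ (1 / 2) ^ (-(K : ℝ)) :=
        Real.rpow_le_rpow_of_nonpos (by norm_num) (by linarith) (neg_nonpos.mpr K.cast_nonneg)
    _ = 2 ^ K := by
        rw [Real.rpow_neg (by norm_num), Real.rpow_natCast, one_div, inv_pow, inv_inv]

theorem abs_oneSubRpowRemainder_le (N : ℕ) {K : ℕ} {r s : ℝ} (hr : -(K : ℝ) ≤ r - N) (hs : 0 ≤ s)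
    (hs2 : s ≤ 1 / 2) : |oneSubRpowRemainder N r s| ≤ 2 ^ K * (|r| + N) ^ N * s ^ N := by
  induction N generalizing r s with
  | zero =>
    have := one_sub_rpow_le_two_pow (by simpa using hr) hs hs2
    simpa [oneSubRpowRemainder, abs_of_nonneg (Real.rpow_nonneg (by linarith : 0 ≤ 1 - s) r)]
  | succ N ih =>
    rw [Nat.cast_succ] at hr ⊢
    have habs : |r - 1| + N ≤ |r| + (N + 1) := by
      linarith [(abs_sub r 1).trans_eq (by rw [abs_one])]
    have hderiv (t : ℝ) (ht : t ∈ Set.Ico 0 s) :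
        ‖-r * oneSubRpowRemainder N (r - 1) t‖ ≤
          (|r| + (N + 1)) * (2 ^ K * (|r| + (N + 1)) ^ N * s ^ N) := by
      obtain ⟨ht0, hts⟩ := ht
      rw [norm_mul, norm_neg, Real.norm_eq_abs, Real.norm_eq_abs]
      have := ih (by linarith : -(K : ℝ) ≤ r - 1 - N) ht0 (by linarith)
      have : |oneSubRpowRemainder N (r - 1) t| ≤ 2 ^ K * (|r| + (N + 1)) ^ N * s ^ N :=
        this.trans (by gcongr)
      gcongr
      linarith [N.cast_nonneg (α := ℝ)]
    have hmvt := norm_image_sub_le_of_norm_deriv_le_segment'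
      (fun t ht => (hasDerivAt_oneSubRpowRemainder_succ N r
        (by linarith [ht.2] : t < 1)).hasDerivWithinAt) hderiv s ⟨hs, le_rfl⟩
    rw [oneSubRpowRemainder_succ_zero, sub_zero, sub_zero, Real.norm_eq_abs] at hmvt
    exact hmvt.trans_eq (by ring)

theorem abs_sum_ringChoose_mul_pow_le (N : ℕ) (r : ℝ) {s : ℝ} (hs : 1 / 2 ≤ s) :
    |∑ n ∈ Finset.range N, (-1) ^ n * Ring.choose r n * s ^ n| ≤
      N * 2 ^ N * (|r| + N) ^ N * s ^ N := by
  have hs0 : 0 ≤ s := by linarith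
  have hterm (n : ℕ) (hn : n ∈ Finset.range N) :
      |(-1) ^ n * Ring.choose r n * s ^ n| ≤ (|r| + N) ^ N * (2 * s) ^ N := by
    have hnN := Finset.mem_range.mp hn
    have hN : (1 : ℝ) ≤ N := by exact_mod_cast hnN.pos
    have hchoose : |Ring.choose r n| ≤ (|r| + N) ^ N :=
      calc |Ring.choose r n| ≤ (1 + |r|) ^ n := abs_ringChoose_le r n
        _ ≤ (1 + |r|) ^ N := pow_le_pow_right₀ (by linarith [abs_nonneg r]) hnN.le
        _ ≤ (|r| + N) ^ N := by gcongr ?_ ^ _; linarith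
    have hpow : s ^ n ≤ (2 * s) ^ N :=
      (pow_le_pow_left₀ hs0 (by linarith) n).trans (pow_le_pow_right₀ (by linarith) hnN.le)
    rw [abs_mul, abs_mul, abs_neg_one_pow, one_mul, abs_pow, abs_of_nonneg hs0]
    gcongr
  calc |∑ n ∈ Finset.range N, (-1) ^ n * Ring.choose r n * s ^ n|
      ≤ ∑ n ∈ Finset.range N, |(-1) ^ n * Ring.choose r n * s ^ n| := Finset.abs_sum_le_sum_abs _ _
    _ ≤ N * ((|r| + N) ^ N * (2 * s) ^ N) := by
        simpa using Finset.sum_le_card_nsmul _ _ _ hterm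
    _ = N * 2 ^ N * (|r| + N) ^ N * s ^ N := by ring

/-! ### Euler's integral for the Kummer function -/

theorem ofReal_rpow_mul_one_sub_rpow {u v s : ℝ} (hs : s ∈ Set.Ioo (0 : ℝ) 1) :
    (s : ℂ) ^ ((u : ℂ) - 1) * (1 - (s : ℂ)) ^ ((v : ℂ) - 1) =
      ((s ^ (u - 1) * (1 - s) ^ (v - 1) : ℝ) : ℂ) := by
  push_cast [Complex.ofReal_cpow hs.1.le, Complex.ofReal_cpow (sub_nonneg.mpr hs.2.le)]
  rfl

theorem integrableOn_rpow_mul_one_sub_rpow {u v : ℝ} (hu : 0 < u) (hv : 0 < v) :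
    IntegrableOn (fun s : ℝ => s ^ (u - 1) * (1 - s) ^ (v - 1)) (Set.Ioo 0 1) := by
  have hcomplex := Complex.betaIntegral_convergent (u := u) (v := v) (by simpa) (by simpa)
  rw [intervalIntegrable_iff_integrableOn_Ioo_of_le zero_le_one,
    integrableOn_congr_fun (fun _ => ofReal_rpow_mul_one_sub_rpow) measurableSet_Ioo] at hcomplex
  exact hcomplex.re

theorem integral_rpow_mul_one_sub_rpow {u v : ℝ} (hu : 0 < u) (hv : 0 < v) :
    ∫ s in Set.Ioo (0 : ℝ) 1, s ^ (u - 1) * (1 - s) ^ (v - 1) = ProbabilityTheory.beta u v := by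
  rw [ProbabilityTheory.beta_eq_betaIntegralReal u v hu hv, Complex.betaIntegral,
    intervalIntegral.integral_of_le zero_le_one, integral_Ioc_eq_integral_Ioo,
    setIntegral_congr_fun measurableSet_Ioo (fun _ => ofReal_rpow_mul_one_sub_rpow),
    integral_complex_ofReal, Complex.ofReal_re]

theorem Gamma_mul_kummerTerm_eq_integral {a b : ℝ} (ha : 0 < a) (hab : a < b) (z : ℝ) (j : ℕ) :
    Real.Gamma (b - a) * kummerTerm a b z j =
      ∫ s in Set.Ioo (0 : ℝ) 1,
        z ^ j / j.factorial * (s ^ (b - a - 1) * (1 - s) ^ (a + j - 1)) := by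
  rw [integral_const_mul, integral_rpow_mul_one_sub_rpow (sub_pos.mpr hab) (by positivity),
    ProbabilityTheory.beta, kummerTerm, show b - a + (a + j) = b + j by ring]
  ring

theorem hasSum_eulerIntegrand (u a z : ℝ) {s : ℝ} (hs : s < 1) :
    HasSum (fun j : ℕ => z ^ j / j.factorial * (s ^ (u - 1) * (1 - s) ^ (a + j - 1)))
      (Real.exp z * (Real.exp (-(z * s)) * (s ^ (u - 1) * (1 - s) ^ (a - 1)))) := by
  have hexp := (hasSum_pow_div_factorial (z * (1 - s))).mul_right
    (s ^ (u - 1) * (1 - s) ^ (a - 1))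
  rw [mul_one_sub, sub_eq_add_neg, Real.exp_add, mul_assoc] at hexp
  refine hexp.congr_fun fun j => ?_
  rw [← sub_eq_add_neg, ← mul_one_sub, mul_pow, add_sub_right_comm,
    Real.rpow_add_natCast (sub_pos.mpr hs).ne']
  ring

theorem scaledKummer_eq_integral {a b z : ℝ} (ha : 0 < a) (hab : a < b) (hz : 0 ≤ z) :
    Real.Gamma (b - a) * scaledKummer a b z =
      ∫ s in Set.Ioo (0 : ℝ) 1, Real.exp (-(z * s)) * (s ^ (b - a - 1) * (1 - s) ^ (a - 1)) := by
  have hnorm (j : ℕ) : ∫ s in Set.Ioo (0 : ℝ) 1,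
      ‖z ^ j / j.factorial * (s ^ (b - a - 1) * (1 - s) ^ (a + j - 1))‖ =
        Real.Gamma (b - a) * kummerTerm a b z j := by
    rw [Gamma_mul_kummerTerm_eq_integral ha hab]
    refine setIntegral_congr_fun measurableSet_Ioo fun s hs => Real.norm_of_nonneg ?_
    have := hs.1
    have := sub_pos.mpr hs.2
    positivity
  have hseries := hasSum_integral_of_summable_integral_norm
    (fun j : ℕ => (integrableOn_rpow_mul_one_sub_rpow (sub_pos.mpr hab)
      (by positivity : 0 < a + j)).const_mul (z ^ j / j.factorial))
    (by simpa only [hnorm] using (summable_kummerTerm a b z).mul_left _)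
  simp only [← Gamma_mul_kummerTerm_eq_integral ha hab] at hseries
  rw [setIntegral_congr_fun measurableSet_Ioo
    fun s hs => (hasSum_eulerIntegrand (b - a) a z hs.2).tsum_eq, integral_const_mul] at hseries
  rw [scaledKummer, mul_left_comm, ← tsum_mul_left, hseries.tsum_eq, ← mul_assoc, ← Real.exp_add,
    neg_add_cancel, Real.exp_zero, one_mul]

/-! ### Uniform large-`z` remainder bounds -/

theorem Gamma_mul_kummerExpansionTerm {a b : ℝ} (hab : a < b) (z : ℝ) (n : ℕ) :
    Real.Gamma (b - a) * kummerExpansionTerm a b z n =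
      (-1) ^ n * Ring.choose (a - 1) n * (Real.Gamma (b - a + n) * z ^ (-(b - a + n))) := by
  rw [Gamma_add_natCast (sub_pos.mpr hab), kummerExpansionTerm,
    show -(b - a + n) = a - b - n by ring]
  ring

theorem setIntegral_mul_indicator {S T : Set ℝ} (hT : MeasurableSet T) (g h : ℝ → ℝ) :
    ∫ s in S, g s * T.indicator h s = ∫ s in S ∩ T, g s * h s := by
  rw [← setIntegral_indicator hT]
  exact integral_congr_ae (ae_of_all _ fun s => (Set.indicator_mul_right T g h).symm)

theorem integrableOn_rpow_mul_indicator {u v : ℝ} (hu : 0 < u) (hv : 0 < v) :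
    IntegrableOn (fun s : ℝ => s ^ (u - 1) * (Set.Iio 1).indicator (fun s => (1 - s) ^ (v - 1)) s)
      (Set.Ioi 0) := by
  have hbeta := integrableOn_rpow_mul_one_sub_rpow hu hv
  rw [← Set.Iio_inter_Ioi, IntegrableOn, ← Measure.restrict_restrict measurableSet_Iio,
    ← IntegrableOn, ← integrable_indicator_iff measurableSet_Iio] at hbeta
  exact hbeta.congr (ae_of_all _ fun s => Set.indicator_mul_right (Set.Iio 1) _ _)

theorem integral_abs_rpow_mul_indicator {u v : ℝ} (hu : 0 < u) (hv : 0 < v) :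
    ∫ s in Set.Ioi (0 : ℝ),
        |s ^ (u - 1) * (Set.Iio 1).indicator (fun s => (1 - s) ^ (v - 1)) s| =
      ProbabilityTheory.beta u v := by
  have habs : Set.EqOn
      (fun s : ℝ => |s ^ (u - 1) * (Set.Iio 1).indicator (fun s => (1 - s) ^ (v - 1)) s|)
      (fun s => s ^ (u - 1) * (Set.Iio 1).indicator (fun s => (1 - s) ^ (v - 1)) s)
      (Set.Ioi 0) := fun s (hs : 0 < s) =>
    abs_of_nonneg (mul_nonneg (by positivity)
      (Set.indicator_nonneg (fun t ht => Real.rpow_nonneg (sub_nonneg.mpr (le_of_lt ht)) _) s))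
  rw [setIntegral_congr_fun measurableSet_Ioi habs, setIntegral_mul_indicator measurableSet_Iio,
    Set.Ioi_inter_Iio, integral_rpow_mul_one_sub_rpow hu hv]

theorem integral_exp_neg_mul_mul_rpow_mul_indicator {a b z : ℝ} (ha : 0 < a) (hab : a < b)
    (hz : 0 ≤ z) :
    ∫ s in Set.Ioi (0 : ℝ), Real.exp (-(z * s)) *
        (s ^ (b - a - 1) * (Set.Iio 1).indicator (fun s => (1 - s) ^ (a - 1)) s) =
      Real.Gamma (b - a) * scaledKummer a b z := by
  simp only [scaledKummer_eq_integral ha hab hz, ← mul_assoc]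
  rw [setIntegral_mul_indicator measurableSet_Iio, Set.Ioi_inter_Iio]

theorem Gamma_mul_abs_kummerRemainder_le (N : ℕ) {a b z : ℝ} (ha : 0 < a) (hab : a < b)
    (hz : 0 < z) :
    Real.Gamma (b - a) * |kummerRemainder N a b z| ≤
      (2 ^ (N + 1) + N * 2 ^ N) * (|a - 1| + N) ^ N *
          (Real.Gamma (b - a + N) * z ^ (-(b - a + N))) +
        Real.exp (-(z * (1 / 2))) * ProbabilityTheory.beta (b - a) a := by
  have hu : 0 < b - a := sub_pos.mpr hab
  have hwatson := abs_integral_exp_neg_mul_sub_sum_le (N := N) (s₀ := 1 / 2)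
    (f := (Set.Iio 1).indicator fun s => (1 - s) ^ (a - 1))
    (c := fun n => (-1) ^ n * Ring.choose (a - 1) n)
    (D := (2 ^ (N + 1) + N * 2 ^ N) * (|a - 1| + N) ^ N)
    hu hz (integrableOn_rpow_mul_indicator hu ha)
    (fun s hs hs2 => by
      rw [Set.indicator_of_mem (by simp only [Set.mem_Iio]; linarith), ← oneSubRpowRemainder]
      refine (abs_oneSubRpowRemainder_le N (K := N + 1) (by push_cast; linarith) hs.le hs2).trans ?_
      gcongr
      exact le_add_of_nonneg_right (by positivity))
    (fun s hs hs2 => (abs_sum_ringChoose_mul_pow_le N (a - 1) hs2.le).trans (by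
      gcongr
      exact le_add_of_nonneg_left (by positivity)))
  rwa [integral_exp_neg_mul_mul_rpow_mul_indicator ha hab hz.le,
    integral_abs_rpow_mul_indicator hu ha,
    ← Finset.sum_congr rfl fun n _ => Gamma_mul_kummerExpansionTerm hab z n, ← Finset.mul_sum,
    ← mul_sub, abs_mul, abs_of_pos (Real.Gamma_pos_of_pos hu), ← kummerRemainder] at hwatson

theorem Gamma_add_one_div_Gamma_le {a b : ℝ} (ha : 0 ≤ a) (hb : 0 < b) (hab : a ≤ b)
    (hba : b ≤ a + 1) : Real.Gamma (a + 1) / Real.Gamma b ≤ 1 + a := by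
  have hG := Real.Gamma_pos_of_pos hb
  have hmax := Real.convexOn_Gamma.le_max_of_mem_Icc (x := b) (y := b + 1) (z := a + 1) hb
    (by simp only [Set.mem_Ioi]; linarith) ⟨hba, by linarith⟩
  rw [Real.Gamma_add_one hb.ne'] at hmax
  rw [div_le_iff₀ hG]
  refine hmax.trans (max_le ?_ ?_)
  · exact le_mul_of_one_le_left hG.le (by linarith)
  · gcongr
    linarith

theorem exp_neg_half_le_rpow (N : ℕ) {c z : ℝ} (hz : 1 ≤ z) (hc : -(N : ℝ) ≤ c) :
    Real.exp (-(z * (1 / 2))) ≤ 2 ^ N * N.factorial * z ^ c := by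
  have hz0 : 0 < z := by linarith
  calc Real.exp (-(z * (1 / 2))) = (Real.exp (z * (1 / 2)))⁻¹ := Real.exp_neg _
    _ ≤ ((z * (1 / 2)) ^ N / N.factorial)⁻¹ :=
        inv_anti₀ (by positivity) (Real.pow_div_factorial_le_exp _ (by positivity) N)
    _ = 2 ^ N * N.factorial * z ^ (-(N : ℝ)) := by
        rw [Real.rpow_neg hz0.le, Real.rpow_natCast, mul_one_div, div_pow, inv_div,
          div_div_eq_mul_div]
        ring
    _ ≤ 2 ^ N * N.factorial * z ^ c := by gcongr

theorem abs_kummerRemainder_le (N : ℕ) {a b z : ℝ} (ha : 0 < a) (hab : a ≤ b) (hz : 0 < z) :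
    |kummerRemainder N a b z| ≤
      (2 ^ (N + 1) + N * 2 ^ N) * (|a - 1| + N) ^ N *
          (pochhammerSymbol (b - a) N * z ^ (a - b - N)) +
        Real.exp (-(z * (1 / 2))) * (Real.Gamma a / Real.Gamma b) := by
  rcases hab.eq_or_lt with rfl | hlt
  · have := Real.Gamma_pos_of_pos ha
    cases N with
    | zero =>
      rw [kummerRemainder_zero, scaledKummer_self ha, pochhammerSymbol_zero, sub_self,
        Nat.cast_zero, sub_zero, Real.rpow_zero]
      have : 0 ≤ Real.exp (-(z * (1 / 2))) * (Real.Gamma a / Real.Gamma a) := by positivity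
      norm_num only [abs_one, pow_zero]
      linarith
    | succ N =>
      rw [kummerRemainder_self N ha, abs_zero, pochhammerSymbol_succ_left, sub_self, zero_mul]
      positivity
  · have hu : 0 < b - a := sub_pos.mpr hlt
    refine le_of_mul_le_mul_left ((Gamma_mul_abs_kummerRemainder_le N ha hlt hz).trans_eq ?_)
      (Real.Gamma_pos_of_pos hu)
    rw [ProbabilityTheory.beta, sub_add_cancel, Gamma_add_natCast hu,
      show -(b - a + N) = a - b - N by ring]
    ring

/-- `KummerRemainderBound K N C M` is the large-`z` error bound for `scaledKummer a b z` with
`a ≤ b + K`, whose dependence on the parameters is at most polynomial. -/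
def KummerRemainderBound (K N : ℕ) (C : ℝ) (M : ℕ) : Prop :=
  ∀ a b z : ℝ, 0 < a → 1 ≤ b → b ≤ a + 1 → a ≤ b + K → 1 ≤ z →
    a * |kummerRemainder N a b z| ≤ C * (1 + a) ^ M * z ^ (a - b - N)

theorem kummerRemainderBound_zero (N : ℕ) :
    KummerRemainderBound 0 N ((2 ^ (N + 1) + N * 2 ^ N) * (N + 1) ^ N * N.factorial +
      2 ^ (N + 1) * (N + 1).factorial) (N + 1) := by
  intro a b z ha hb hba hab hz
  replace hab : a ≤ b := by simpa using hab
  have hz0 : 0 < z := by linarith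
  have hshift : |a - 1| + N ≤ (N + 1) * (1 + a) := by
    have : |a - 1| ≤ 1 + a := abs_le.mpr ⟨by linarith, by linarith⟩
    nlinarith [N.cast_nonneg (α := ℝ)]
  have hpoch := pochhammerSymbol_le_factorial (sub_nonneg.mpr hab) (by linarith : b - a ≤ 1) N
  have := pochhammerSymbol_nonneg (sub_nonneg.mpr hab) N
  have hexp := exp_neg_half_le_rpow (N + 1) hz
    (by push_cast; linarith : -((N + 1 : ℕ) : ℝ) ≤ a - b - N)
  have hGamma := Gamma_add_one_div_Gamma_le ha.le (by linarith) hab hba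
  have : 0 < Real.Gamma (a + 1) := Real.Gamma_pos_of_pos (by linarith)
  have : 0 < Real.Gamma b := Real.Gamma_pos_of_pos (by linarith)
  calc a * |kummerRemainder N a b z|
      ≤ a * ((2 ^ (N + 1) + N * 2 ^ N) * (|a - 1| + N) ^ N *
          (pochhammerSymbol (b - a) N * z ^ (a - b - N)) +
            Real.exp (-(z * (1 / 2))) * (Real.Gamma a / Real.Gamma b)) := by
        gcongr
        exact abs_kummerRemainder_le N ha hab hz0
    _ = a * ((2 ^ (N + 1) + N * 2 ^ N) * (|a - 1| + N) ^ N *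
          (pochhammerSymbol (b - a) N * z ^ (a - b - N))) +
            Real.exp (-(z * (1 / 2))) * (Real.Gamma (a + 1) / Real.Gamma b) := by
        rw [Real.Gamma_add_one ha.ne']
        ring
    _ ≤ (1 + a) * ((2 ^ (N + 1) + N * 2 ^ N) * ((N + 1) * (1 + a)) ^ N *
          (N.factorial * z ^ (a - b - N))) +
            2 ^ (N + 1) * (N + 1).factorial * z ^ (a - b - N) * (1 + a) ^ (N + 1) := by
        have : 1 + a ≤ (1 + a) ^ (N + 1) := le_self_pow₀ (by linarith) N.succ_ne_zero
        gcongr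
        · linarith
        · exact hGamma.trans this
    _ = _ := by
        rw [mul_pow]
        ring

theorem abs_kummerRemainder_le_add (N : ℕ) {a z : ℝ} (ha : 1 < a) (hz : 0 < z) (b : ℝ) :
    |kummerRemainder N a b z| ≤ z * |kummerRemainder N a (b + 1) z| +
      (a - 1) * |kummerRemainder (N - 1) (a - 1) b z| := by
  have hrec := kummerRemainder_add_one N (sub_pos.mpr ha) hz.ne' b
  rw [sub_add_cancel] at hrec
  rw [hrec]
  refine (abs_add_le _ _).trans_eq ?_
  rw [abs_mul, abs_mul, abs_of_pos hz, abs_of_pos (sub_pos.mpr ha)]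

theorem KummerRemainderBound.succ {K N M M' : ℕ} {C C' : ℝ} (hC : 0 ≤ C) (hC' : 0 ≤ C')
    (hbound : KummerRemainderBound K N C M) (hbound' : KummerRemainderBound K (N - 1) C' M') :
    KummerRemainderBound (K + 1) N (C + C') (M + M' + 1) := by
  intro a b z ha hb hba hab hz
  have hz0 : 0 < z := by linarith
  have ha1 : 1 ≤ 1 + a := by linarith
  push_cast at hab
  rcases le_or_gt a b with hle | hlt
  · have hK : a ≤ b + K := hle.trans (le_add_of_nonneg_right K.cast_nonneg)
    refine (hbound a b z ha hb hba hK hz).trans ?_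
    gcongr
    · linarith
    · lia
  have hmain := hbound a (b + 1) z ha (by linarith) (by linarith) (by linarith) hz
  have hexponent : a - 1 - b - (N - 1 : ℕ) ≤ a - b - N := by
    have : (N : ℝ) ≤ (N - 1 : ℕ) + 1 := by exact_mod_cast (by lia : N ≤ N - 1 + 1)
    linarith
  have hshift : (a - 1) * |kummerRemainder (N - 1) (a - 1) b z| ≤
      C' * (1 + a) ^ M' * z ^ (a - b - N) := by
    refine (hbound' (a - 1) b z (by linarith) hb (by linarith) (by linarith) hz).trans ?_
    gcongr <;> linarith
  have hzpow : z * z ^ (a - (b + 1) - N) = z ^ (a - b - N) := by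
    rw [mul_comm, ← Real.rpow_add_one hz0.ne']
    ring_nf
  calc a * |kummerRemainder N a b z|
      ≤ a * (z * |kummerRemainder N a (b + 1) z| +
          (a - 1) * |kummerRemainder (N - 1) (a - 1) b z|) := by
        gcongr
        exact abs_kummerRemainder_le_add N (hb.trans_lt hlt) hz0 b
    _ = z * (a * |kummerRemainder N a (b + 1) z|) +
          a * ((a - 1) * |kummerRemainder (N - 1) (a - 1) b z|) := by ring
    _ ≤ z * (C * (1 + a) ^ M * z ^ (a - (b + 1) - N)) +
          (1 + a) * (C' * (1 + a) ^ M' * z ^ (a - b - N)) := by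
        refine add_le_add (by gcongr) (mul_le_mul (by linarith) hshift ?_ (by linarith))
        exact mul_nonneg (by linarith) (abs_nonneg _)
    _ = C * (1 + a) ^ M * z ^ (a - b - N) + C' * (1 + a) ^ (M' + 1) * z ^ (a - b - N) := by
        rw [← hzpow]
        ring
    _ ≤ C * (1 + a) ^ (M + M' + 1) * z ^ (a - b - N) +
          C' * (1 + a) ^ (M + M' + 1) * z ^ (a - b - N) := by gcongr <;> lia
    _ = (C + C') * (1 + a) ^ (M + M' + 1) * z ^ (a - b - N) := by ring

theorem exists_kummerRemainderBound (K N : ℕ) :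
    ∃ C M, 0 ≤ C ∧ KummerRemainderBound K N C M := by
  induction K generalizing N with
  | zero => exact ⟨_, _, by positivity, kummerRemainderBound_zero N⟩
  | succ K ih =>
    obtain ⟨C, M, hC, hbound⟩ := ih N
    obtain ⟨C', M', hC', hbound'⟩ := ih (N - 1)
    exact ⟨C + C', M + M' + 1, by positivity, hbound.succ hC hC' hbound'⟩

/-! ### The power series of the noncentral beta distribution -/

section NoncentralBeta

variable {a b p q x y : ℝ}

theorem intervalIntegrable_betaDensity (ha : 0 < a) (hy0 : 0 ≤ y) (hy1 : y < 1) :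
    IntervalIntegrable (fun t : ℝ => t ^ (a - 1) * (1 - t) ^ (b - 1)) volume 0 y := by
  refine (intervalIntegral.intervalIntegrable_rpow' (by linarith)).mul_continuousOn ?_
  refine ContinuousOn.rpow_const (by fun_prop) fun t ht => Or.inl ?_
  rw [Set.uIcc_of_le hy0] at ht
  linarith [ht.2]

theorem integral_betaDensity_nonneg (hy0 : 0 ≤ y) (hy1 : y < 1) :
    0 ≤ ∫ t in (0 : ℝ)..y, t ^ (a - 1) * (1 - t) ^ (b - 1) :=
  intervalIntegral.integral_nonneg hy0 fun _ ht =>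
    mul_nonneg (Real.rpow_nonneg ht.1 _) (Real.rpow_nonneg (by linarith [ht.2]) _)

theorem integral_betaDensity_add_natCast_le (ha : 0 < a) (hy0 : 0 ≤ y) (hy1 : y < 1) (n : ℕ) :
    ∫ t in (0 : ℝ)..y, t ^ (a + n - 1) * (1 - t) ^ (b - 1) ≤
      y ^ n * ∫ t in (0 : ℝ)..y, t ^ (a - 1) * (1 - t) ^ (b - 1) := by
  rw [← intervalIntegral.integral_const_mul]
  refine intervalIntegral.integral_mono_on_of_le_Ioo hy0
    (intervalIntegrable_betaDensity (by positivity) hy0 hy1)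
    ((intervalIntegrable_betaDensity ha hy0 hy1).const_mul _) fun t ⟨ht0, hty⟩ => ?_
  have : 0 ≤ (1 - t) ^ (b - 1) := Real.rpow_nonneg (by linarith) _
  calc t ^ (a + n - 1) * (1 - t) ^ (b - 1) = t ^ n * (t ^ (a - 1) * (1 - t) ^ (b - 1)) := by
        rw [add_sub_right_comm, Real.rpow_add_natCast ht0.ne']
        ring
    _ ≤ y ^ n * (t ^ (a - 1) * (1 - t) ^ (b - 1)) := by gcongr

theorem hasDerivAt_rpow_mul_one_sub_rpow {t : ℝ} (ht0 : 0 < t) (ht1 : t < 1) :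
    HasDerivAt (fun t : ℝ => t ^ a * (1 - t) ^ b)
      (a * (t ^ (a - 1) * (1 - t) ^ (b - 1)) -
        (a + b) * (t ^ (a + 1 - 1) * (1 - t) ^ (b - 1))) t := by
  have ht1' : 1 - t ≠ 0 := by linarith
  have hpow := Real.hasDerivAt_rpow_const (p := a) (Or.inl ht0.ne')
  have hpow' := ((hasDerivAt_id t).const_sub 1).rpow_const (p := b) (Or.inl ht1')
  refine (hpow.mul hpow').congr_deriv ?_
  simp only [id, add_sub_cancel_right, Real.rpow_sub_one ht0.ne', Real.rpow_sub_one ht1']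
  field_simp
  ring

theorem rpow_mul_one_sub_rpow_eq_integral (ha : 0 < a) (hb : 0 ≤ b) (hy0 : 0 ≤ y) (hy1 : y < 1) :
    y ^ a * (1 - y) ^ b = a * (∫ t in (0 : ℝ)..y, t ^ (a - 1) * (1 - t) ^ (b - 1)) -
      (a + b) * ∫ t in (0 : ℝ)..y, t ^ (a + 1 - 1) * (1 - t) ^ (b - 1) := by
  have hint := (intervalIntegrable_betaDensity (b := b) ha hy0 hy1).const_mul a
  have hint' := (intervalIntegrable_betaDensity (a := a + 1) (b := b) (by linarith)
    hy0 hy1).const_mul (a + b)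
  have hcont : ContinuousOn (fun t : ℝ => t ^ a * (1 - t) ^ b) (Set.Icc 0 y) :=
    (ContinuousOn.rpow_const (by fun_prop) fun _ _ => Or.inr ha.le).mul
      (ContinuousOn.rpow_const (by fun_prop) fun _ _ => Or.inr hb)
  rw [← intervalIntegral.integral_const_mul, ← intervalIntegral.integral_const_mul,
    ← intervalIntegral.integral_sub hint hint',
    intervalIntegral.integral_eq_sub_of_hasDerivAt_of_le hy0 hcont
      (fun t ht => hasDerivAt_rpow_mul_one_sub_rpow ht.1 (ht.2.trans hy1)) (hint.sub hint'),
    Real.zero_rpow ha.ne', zero_mul, sub_zero]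

theorem centralBetaCDF_eq_add (ha : 0 < a) (hb : 0 < b) (hy0 : 0 ≤ y) (hy1 : y < 1) :
    centralBetaCDF a b y = centralBetaCDF (a + 1) b y +
      y ^ a * (1 - y) ^ b / Real.Gamma b * (Real.Gamma (a + b) / Real.Gamma (a + 1)) := by
  have := (Real.Gamma_pos_of_pos ha).ne'
  have := (Real.Gamma_pos_of_pos hb).ne'
  have := (Real.Gamma_pos_of_pos (add_pos ha hb)).ne'
  have hab : a + b ≠ 0 := by positivity
  rw [rpow_mul_one_sub_rpow_eq_integral ha hb.le hy0 hy1, centralBetaCDF, centralBetaCDF,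
    ProbabilityTheory.beta, ProbabilityTheory.beta, add_right_comm a 1 b,
    Real.Gamma_add_one ha.ne', Real.Gamma_add_one hab]
  field_simp
  ring

theorem centralBetaCDF_nonneg (ha : 0 < a) (hb : 0 < b) (hy0 : 0 ≤ y) (hy1 : y < 1) :
    0 ≤ centralBetaCDF a b y :=
  mul_nonneg (one_div_nonneg.mpr (ProbabilityTheory.beta_pos ha hb).le)
    (integral_betaDensity_nonneg hy0 hy1)

theorem centralBetaCDF_add_one_le (ha : 0 < a) (hb : 0 < b) (hy0 : 0 ≤ y) (hy1 : y < 1) :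
    centralBetaCDF (a + 1) b y ≤ centralBetaCDF a b y := by
  rw [centralBetaCDF_eq_add ha hb hy0 hy1, le_add_iff_nonneg_right]
  have := Real.Gamma_pos_of_pos hb
  have := Real.Gamma_pos_of_pos (add_pos ha hb)
  have := Real.Gamma_pos_of_pos (s := a + 1) (by linarith)
  have : 0 ≤ (1 - y) ^ b := Real.rpow_nonneg (by linarith) b
  positivity

theorem centralBetaCDF_add_natCast_le (ha : 0 < a) (hb : 0 < b) (hy0 : 0 ≤ y) (hy1 : y < 1)
    (n : ℕ) : centralBetaCDF (a + n) b y ≤ centralBetaCDF a b y := by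
  induction n with
  | zero => simp
  | succ n ih =>
    push_cast
    rw [← add_assoc]
    exact (centralBetaCDF_add_one_le (by positivity) hb hy0 hy1).trans ih

theorem tendsto_Gamma_div_Gamma_mul_pow (ha : 0 < a) (hb : 0 < b) (hy0 : 0 < y) (hy1 : y < 1) :
    Tendsto (fun n : ℕ => Real.Gamma (a + b + n) / Real.Gamma (a + n) * y ^ n) atTop (𝓝 0) := by
  set u : ℕ → ℝ := fun n => Real.Gamma (a + b + n) / Real.Gamma (a + n) * y ^ n with hu
  have hupos (n : ℕ) : 0 < u n := by
    have := Real.Gamma_pos_of_pos (s := a + b + n) (by positivity)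
    have := Real.Gamma_pos_of_pos (s := a + n) (by positivity)
    positivity
  have hratio (n : ℕ) : u (n + 1) = (a + b + n) / (a + n) * y * u n := by
    simp only [hu, Nat.cast_add_one, ← add_assoc]
    rw [Real.Gamma_add_one (s := a + b + n) (by positivity),
      Real.Gamma_add_one (s := a + n) (by positivity), pow_succ, mul_div_mul_comm]
    ring
  have hlim := (tendsto_add_natCast_div_add_natCast (a + b) a).mul_const y
  rw [one_mul] at hlim
  obtain ⟨r, hyr, hr1⟩ := exists_between hy1
  refine (summable_of_ratio_norm_eventually_le hr1 ?_).tendsto_atTop_zero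
  filter_upwards [hlim.eventually_le_const hyr] with n hn
  rw [Real.norm_of_nonneg (hupos _).le, Real.norm_of_nonneg (hupos _).le, hratio]
  exact mul_le_mul_of_nonneg_right hn (hupos n).le

theorem tendsto_centralBetaCDF_add_natCast (ha : 0 < a) (hb : 0 < b) (hy0 : 0 < y) (hy1 : y < 1) :
    Tendsto (fun n : ℕ => centralBetaCDF (a + n) b y) atTop (𝓝 0) := by
  set J := ∫ t in (0 : ℝ)..y, t ^ (a - 1) * (1 - t) ^ (b - 1)
  have hbound (n : ℕ) : centralBetaCDF (a + n) b y ≤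
      Real.Gamma (a + b + n) / Real.Gamma (a + n) * y ^ n * (J / Real.Gamma b) := by
    have := Real.Gamma_pos_of_pos hb
    have := Real.Gamma_pos_of_pos (s := a + n) (by positivity)
    have := Real.Gamma_pos_of_pos (s := a + b + n) (by positivity)
    rw [centralBetaCDF, ProbabilityTheory.beta, one_div_div, add_right_comm a n b]
    refine (mul_le_mul_of_nonneg_left
      (integral_betaDensity_add_natCast_le ha hy0.le hy1 n) (by positivity)).trans_eq ?_
    ring
  have hlim := (tendsto_Gamma_div_Gamma_mul_pow ha hb hy0 hy1).mul_const (J / Real.Gamma b)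
  rw [zero_mul] at hlim
  exact squeeze_zero (fun n => centralBetaCDF_nonneg (by positivity) hb hy0.le hy1) hbound hlim

theorem hasSum_poissonWeight (u : ℝ) :
    HasSum (fun j : ℕ => 1 / (j.factorial : ℝ) * u ^ j) (Real.exp u) := by
  simpa only [one_div_mul_eq_div] using hasSum_pow_div_factorial u

theorem summable_noncentralBetaCDF (hp : 0 < p) (hq : 0 < q) (hx : 0 ≤ x) (hy0 : 0 ≤ y)
    (hy1 : y < 1) :
    Summable fun j : ℕ => 1 / (j.factorial : ℝ) * (x / 2) ^ j * centralBetaCDF (p + j) q y := by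
  refine Summable.of_nonneg_of_le (fun j => ?_) (fun j => ?_)
    ((hasSum_poissonWeight (x / 2)).summable.mul_right (centralBetaCDF p q y))
  · have := centralBetaCDF_nonneg (a := p + j) (by positivity) hq hy0 hy1
    positivity
  · have := centralBetaCDF_add_natCast_le hp hq hy0 hy1 j
    gcongr

theorem noncentralBetaCDF_nonneg (hp : 0 < p) (hq : 0 < q) (hx : 0 ≤ x) (hy0 : 0 ≤ y)
    (hy1 : y < 1) : 0 ≤ noncentralBetaCDF p q x y := by
  refine mul_nonneg (Real.exp_pos _).le (tsum_nonneg fun j => ?_)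
  have := centralBetaCDF_nonneg (a := p + j) (by positivity) hq hy0 hy1
  positivity

theorem noncentralBetaCDF_le_centralBetaCDF (hp : 0 < p) (hq : 0 < q) (hx : 0 ≤ x) (hy0 : 0 ≤ y)
    (hy1 : y < 1) : noncentralBetaCDF p q x y ≤ centralBetaCDF p q y := by
  have hweight := (hasSum_poissonWeight (x / 2)).mul_right (centralBetaCDF p q y)
  calc noncentralBetaCDF p q x y
      ≤ Real.exp (-x / 2) *
          ∑' j : ℕ, 1 / (j.factorial : ℝ) * (x / 2) ^ j * centralBetaCDF p q y := by
        refine mul_le_mul_of_nonneg_left ?_ (Real.exp_pos _).le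
        refine (summable_noncentralBetaCDF hp hq hx hy0 hy1).tsum_le_tsum (fun j => ?_)
          hweight.summable
        have := centralBetaCDF_add_natCast_le hp hq hy0 hy1 j
        gcongr
    _ = centralBetaCDF p q y := by
        rw [hweight.tsum_eq, ← mul_assoc, ← Real.exp_add, neg_div, neg_add_cancel, Real.exp_zero,
          one_mul]

theorem tendsto_noncentralBetaCDF_add_natCast (hp : 0 < p) (hq : 0 < q) (hx : 0 ≤ x)
    (hy0 : 0 < y) (hy1 : y < 1) :
    Tendsto (fun n : ℕ => noncentralBetaCDF (p + n) q x y) atTop (𝓝 0) :=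
  squeeze_zero (fun _ => noncentralBetaCDF_nonneg (by positivity) hq hx hy0.le hy1)
    (fun _ => noncentralBetaCDF_le_centralBetaCDF (by positivity) hq hx hy0.le hy1)
    (tendsto_centralBetaCDF_add_natCast hp hq hy0 hy1)

/-- The factor `e^{-(1-y)x/2} y^p (1-y)^q / Γ(q)` of the Kummer function `scaledKummer` in the
difference of `B_{p,q}(x,y)` and `B_{p+1,q}(x,y)`. -/
noncomputable def kummerPrefactor (p q x y : ℝ) : ℝ :=
  Real.exp (-(1 - y) * x / 2) * (y ^ p * (1 - y) ^ q / Real.Gamma q)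

theorem kummerPrefactor_nonneg (hq : 0 ≤ q) (hy0 : 0 ≤ y) (hy1 : y ≤ 1) :
    0 ≤ kummerPrefactor p q x y := by
  have := Real.Gamma_nonneg_of_nonneg hq
  have : 0 ≤ (1 - y) ^ q := Real.rpow_nonneg (by linarith) q
  rw [kummerPrefactor]
  positivity

theorem noncentralBetaCDF_sub (hp : 0 < p) (hq : 0 < q) (hx : 0 ≤ x) (hy0 : 0 < y) (hy1 : y < 1) :
    noncentralBetaCDF p q x y - noncentralBetaCDF (p + 1) q x y =
      kummerPrefactor p q x y * scaledKummer (p + q) (p + 1) (x * y / 2) := by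
  have hterm (j : ℕ) : 1 / (j.factorial : ℝ) * (x / 2) ^ j * centralBetaCDF (p + j) q y -
      1 / (j.factorial : ℝ) * (x / 2) ^ j * centralBetaCDF (p + 1 + j) q y =
      y ^ p * (1 - y) ^ q / Real.Gamma q * kummerTerm (p + q) (p + 1) (x * y / 2) j := by
    rw [centralBetaCDF_eq_add (a := p + j) (by positivity) hq hy0.le hy1, kummerTerm,
      add_right_comm p 1, add_right_comm p q, Real.rpow_add_natCast hy0.ne', mul_div_right_comm x,
      mul_pow]
    ring
  have hexp : Real.exp (-(1 - y) * x / 2) * Real.exp (-(x * y / 2)) = Real.exp (-x / 2) := by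
    rw [← Real.exp_add]
    ring_nf
  rw [noncentralBetaCDF, noncentralBetaCDF, ← mul_sub,
    ← (summable_noncentralBetaCDF hp hq hx hy0.le hy1).tsum_sub
      (summable_noncentralBetaCDF (by linarith) hq hx hy0.le hy1),
    tsum_congr hterm, tsum_mul_left, scaledKummer, kummerPrefactor, ← hexp]
  ring

theorem hasSum_noncentralBetaCDF (hp : 0 < p) (hq : 0 < q) (hx : 0 ≤ x) (hy0 : 0 < y)
    (hy1 : y < 1) :
    HasSum (fun m : ℕ => kummerPrefactor p q x y *
      (y ^ m * scaledKummer (p + q + m) (p + m + 1) (x * y / 2))) (noncentralBetaCDF p q x y) := by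
  have hdiff (m : ℕ) : kummerPrefactor p q x y *
      (y ^ m * scaledKummer (p + q + m) (p + m + 1) (x * y / 2)) =
      noncentralBetaCDF (p + m) q x y - noncentralBetaCDF (p + (m + 1 : ℕ)) q x y := by
    rw [Nat.cast_add_one, ← add_assoc, noncentralBetaCDF_sub (by positivity) hq hx hy0 hy1,
      kummerPrefactor, kummerPrefactor, Real.rpow_add_natCast hy0.ne', add_right_comm p q]
    ring
  rw [hasSum_iff_tendsto_nat_of_nonneg]
  · simp_rw [hdiff, Finset.sum_range_sub' fun m : ℕ => noncentralBetaCDF (p + m) q x y]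
    simpa using (tendsto_noncentralBetaCDF_add_natCast hp hq hx hy0 hy1).const_sub
      (noncentralBetaCDF p q x y)
  · intro m
    have := kummerPrefactor_nonneg (p := p) (x := x) hq.le hy0.le hy1.le
    have := scaledKummer_nonneg (a := p + q + m) (b := p + m + 1) (z := x * y / 2)
      (by positivity) (by positivity) (by positivity)
    positivity

end NoncentralBeta

/-! ### The large-`z` expansion -/

theorem summable_pow_mul_add_pow (M : ℕ) {r : ℝ} (hr0 : 0 ≤ r) (hr1 : r < 1) (s : ℝ) :
    Summable fun m : ℕ => r ^ m * (s + m) ^ M := by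
  simp_rw [add_pow, Finset.mul_sum]
  refine summable_sum fun i _ => ?_
  refine ((summable_pow_mul_geometric_of_norm_lt_one (M - i)
    (by rwa [Real.norm_of_nonneg hr0])).mul_left (s ^ i * M.choose i)).congr fun m => ?_
  ring

theorem tsum_pow_mul_add_pow_mono (M : ℕ) {r r' s s' : ℝ} (hr : 0 ≤ r) (hrr' : r ≤ r')
    (hr' : r' < 1) (hs : 0 ≤ s) (hss' : s ≤ s') :
    ∑' m : ℕ, r ^ m * (s + m) ^ M ≤ ∑' m : ℕ, r' ^ m * (s' + m) ^ M := by
  have hr0 := hr.trans hrr'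
  exact (summable_pow_mul_add_pow M hr (hrr'.trans_lt hr') s).tsum_le_tsum (fun _ => by gcongr)
    (summable_pow_mul_add_pow M hr0 hr' s')

section LargeZ

variable {p q x y : ℝ}

theorem largeZPrefactor_nonneg (hq : 0 ≤ q) (hx : 0 ≤ x) (hy0 : 0 ≤ y) (hy1 : y ≤ 1) :
    0 ≤ largeZPrefactor p q x y := by
  have := Real.Gamma_nonneg_of_nonneg hq
  have : 0 ≤ (1 - y) ^ (q - 1) := Real.rpow_nonneg (by linarith) _
  rw [largeZPrefactor]
  positivity

theorem kummerPrefactor_mul_rpow (hz : x * y / 2 ≠ 0) (hy1 : y ≠ 1) (n : ℕ) :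
    kummerPrefactor p q x y * (x * y / 2) ^ (q - 1 - n) =
      largeZPrefactor p q x y / (x * y / 2) ^ n * (1 - y) := by
  have hy : 1 - y ≠ 0 := sub_ne_zero.mpr hy1.symm
  rw [kummerPrefactor, largeZPrefactor, Real.rpow_sub_natCast hz, Real.rpow_sub_one hy]
  field_simp

theorem hasSum_kummerExpansionTerm (hx : x ≠ 0) (hy0 : 0 < y) (hy1 : y < 1) (n : ℕ) :
    HasSum (fun m : ℕ => kummerPrefactor p q x y *
        (y ^ m * kummerExpansionTerm (p + q + m) (p + m + 1) (x * y / 2) n))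
      (largeZPrefactor p q x y * largeZTerm p q x y n) := by
  have hy : 1 - y ≠ 0 := by linarith
  have hvalue : kummerPrefactor p q x y * (x * y / 2) ^ (q - 1 - n) *
      ((-1) ^ n * pochhammerSymbol (1 - q) n) * (coeffC p q y n / (1 - y)) =
      largeZPrefactor p q x y * largeZTerm p q x y n := by
    rw [kummerPrefactor_mul_rpow (by positivity) hy1.ne, largeZTerm]
    field_simp
  rw [← hvalue]
  refine ((hasSum_pow_mul_ringChoose p q (abs_lt.mpr ⟨by linarith, hy1⟩) n).mul_left
    (kummerPrefactor p q x y * (x * y / 2) ^ (q - 1 - n) *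
      ((-1) ^ n * pochhammerSymbol (1 - q) n))).congr_fun fun m => ?_
  rw [kummerExpansionTerm, show p + q + m - (p + m + 1) = q - 1 by ring,
    show p + m + 1 - (p + q + m) = 1 - q by ring, show p + q + m - 1 = p + q - 1 + m by ring]
  ring

theorem hasSum_noncentralBetaCDF_sub_expansion (N : ℕ) (hp : 0 < p) (hq : 0 < q) (hx : 0 < x)
    (hy0 : 0 < y) (hy1 : y < 1) :
    HasSum (fun m : ℕ => kummerPrefactor p q x y *
        (y ^ m * kummerRemainder N (p + q + m) (p + m + 1) (x * y / 2)))
      (noncentralBetaCDF p q x y -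
        largeZPrefactor p q x y * ∑ n ∈ Finset.range N, largeZTerm p q x y n) := by
  simp only [kummerRemainder, mul_sub, Finset.mul_sum]
  exact (hasSum_noncentralBetaCDF hp hq hx.le hy0 hy1).sub
    (hasSum_sum fun n _ => hasSum_kummerExpansionTerm hx.ne' hy0 hy1 n)

theorem abs_noncentralBetaCDF_sub_expansion_le {K N M : ℕ} {C : ℝ} (hC : 0 ≤ C)
    (hbound : KummerRemainderBound K N C M) (hp : 0 < p) (hq : 0 < q) (hqK : q ≤ K + 1)
    (hy0 : 0 < y) (hy1 : y < 1) (hz : 1 ≤ x * y / 2) :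
    |noncentralBetaCDF p q x y -
        largeZPrefactor p q x y * ∑ n ∈ Finset.range N, largeZTerm p q x y n| ≤
      C / (p + q) * (∑' m : ℕ, y ^ m * (1 + (p + q) + m) ^ M) *
        (largeZPrefactor p q x y / (x * y / 2) ^ N) := by
  have hx : 0 < x := pos_of_mul_pos_left (by linarith) hy0.le
  have hE := kummerPrefactor_nonneg (p := p) (x := x) hq.le hy0.le hy1.le
  have hP := largeZPrefactor_nonneg (p := p) hq.le hx.le hy0.le hy1.le
  have hremainder (m : ℕ) : |kummerRemainder N (p + q + m) (p + m + 1) (x * y / 2)| ≤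
      C / (p + q) * (1 + (p + q) + m) ^ M * (x * y / 2) ^ (q - 1 - N) := by
    have := m.cast_nonneg (α := ℝ)
    have ham := hbound (p + q + m) (p + m + 1) (x * y / 2) (by positivity) (by linarith)
      (by linarith) (by linarith) hz
    rw [show p + q + m - (p + m + 1) - N = q - 1 - N by ring, ← add_assoc] at ham
    rw [div_mul_eq_mul_div, div_mul_eq_mul_div, le_div_iff₀' (by positivity)]
    exact (mul_le_mul_of_nonneg_right (by linarith) (abs_nonneg _)).trans ham
  have hterm (m : ℕ) : ‖kummerPrefactor p q x y *
      (y ^ m * kummerRemainder N (p + q + m) (p + m + 1) (x * y / 2))‖ ≤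
      kummerPrefactor p q x y * (x * y / 2) ^ (q - 1 - N) * (C / (p + q)) *
        (y ^ m * (1 + (p + q) + m) ^ M) := by
    rw [norm_mul, norm_mul, norm_pow, Real.norm_of_nonneg hE, Real.norm_of_nonneg hy0.le,
      Real.norm_eq_abs]
    refine (mul_le_mul_of_nonneg_left (mul_le_mul_of_nonneg_left (hremainder m)
      (by positivity)) hE).trans_eq ?_
    ring
  have hsum := (summable_pow_mul_add_pow M hy0.le hy1 (1 + (p + q))).hasSum
  rw [← (hasSum_noncentralBetaCDF_sub_expansion N hp hq hx hy0 hy1).tsum_eq, ← Real.norm_eq_abs]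
  refine (tsum_of_norm_bounded (hsum.mul_left _) hterm).trans ?_
  rw [kummerPrefactor_mul_rpow (by linarith) hy1.ne, mul_assoc, mul_comm]
  refine mul_le_mul_of_nonneg_left (mul_le_of_le_one_right (by positivity) (by linarith)) ?_
  exact mul_nonneg (by positivity) (tsum_nonneg fun m => by positivity)

theorem exists_abs_noncentralBetaCDF_sub_expansion_le (R : ℝ) {ε δ : ℝ} (hε : 0 < ε)
    (hδ : 0 < δ) (N : ℕ) :
    ∃ C : ℝ, 0 < C ∧ ∀ p q x y : ℝ, 0 < p → p ≤ R → 0 < q → q ≤ R → ε ≤ p + q → 0 < y →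
      y ≤ 1 - δ → 1 ≤ x * y / 2 →
      |noncentralBetaCDF p q x y -
          largeZPrefactor p q x y * ∑ n ∈ Finset.range N, largeZTerm p q x y n| ≤
        C * largeZPrefactor p q x y / (x * y / 2) ^ N := by
  obtain ⟨C, M, hC, hbound⟩ := exists_kummerRemainderBound ⌈R⌉₊ N
  set S : ℝ := ∑' m : ℕ, (1 - δ) ^ m * (1 + (R + R) + m) ^ M
  refine ⟨max (C / ε * S) 1, lt_max_of_lt_right one_pos,
    fun p q x y hp hpR hq hqR hpq hy0 hyδ hz => ?_⟩
  have hx : 0 < x := pos_of_mul_pos_left (by linarith) hy0.le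
  have hP := largeZPrefactor_nonneg (p := p) hq.le hx.le hy0.le (by linarith)
  have hsum : ∑' m : ℕ, y ^ m * (1 + (p + q) + m) ^ M ≤ S :=
    tsum_pow_mul_add_pow_mono M hy0.le hyδ (by linarith) (by linarith) (by linarith)
  refine (abs_noncentralBetaCDF_sub_expansion_le hC hbound hp hq
    (by linarith [Nat.le_ceil R]) hy0 (by linarith) hz).trans ?_
  rw [mul_div_assoc (max _ _)]
  refine mul_le_mul_of_nonneg_right (le_max_of_le_left ?_) (by positivity)
  gcongr

theorem largeZTerm_natCast_eq_zero {k n : ℕ} (hk : 1 ≤ k) (hkn : k ≤ n) :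
    largeZTerm p k x y n = 0 := by
  rw [largeZTerm, pochhammerSymbol_one_sub_natCast_of_le hk hkn, mul_zero, zero_mul]

theorem noncentralBetaCDF_natCast {k : ℕ} (hp : 0 < p) (hk : 1 ≤ k) (hx : 0 < x) (hy0 : 0 < y)
    (hy1 : y < 1) :
    noncentralBetaCDF p k x y =
      largeZPrefactor p k x y * ∑ n ∈ Finset.range k, largeZTerm p k x y n := by
  obtain ⟨l, rfl⟩ := Nat.exists_eq_add_of_le' hk
  have hremainder (m : ℕ) :
      kummerRemainder (l + 1) (p + (l + 1 : ℕ) + m) (p + m + 1) (x * y / 2) = 0 := by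
    have hl : (l : ℝ) < p + (l + 1 : ℕ) + m := by
      push_cast
      linarith [m.cast_nonneg (α := ℝ)]
    rw [show p + m + 1 = p + (l + 1 : ℕ) + m - l by push_cast; ring]
    exact kummerRemainder_sub_natCast l.lt_succ_self hl (by positivity)
  have hsum := hasSum_noncentralBetaCDF_sub_expansion (l + 1) hp
    (Nat.cast_pos.mpr l.succ_pos) hx hy0 hy1
  simp only [hremainder, mul_zero] at hsum
  exact sub_eq_zero.mp (hsum.unique hasSum_zero)

end LargeZ

/-- Large-`z` expansion (`z = xy/2`) of the cumulative noncentral beta distribution function,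
with every remainder uniform in `p`, `q`, `y`, and its exactness for positive integers `q`. -/
theorem mainTheorem6 :
    (∀ (R ε δ : ℝ), 0 < R → 0 < ε → 0 < δ → ∀ N : ℕ,
      ∃ C Z : ℝ, 0 < C ∧ 0 < Z ∧
        ∀ p q x y : ℝ, 0 < p → p ≤ R → 0 < q → q ≤ R → ε ≤ p + q →
          0 < y → y ≤ 1 - δ → Z ≤ x * y / 2 →
          |noncentralBetaCDF p q x y -
              largeZPrefactor p q x y * ∑ n ∈ Finset.range N, largeZTerm p q x y n| ≤
            C * largeZPrefactor p q x y / (x * y / 2) ^ N) ∧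
    (∀ (p x y : ℝ) (k : ℕ), 0 < p → 1 ≤ k → 0 < x → 0 < y → y < 1 →
      (∀ n : ℕ, k ≤ n → largeZTerm p (k : ℝ) x y n = 0) ∧
      noncentralBetaCDF p (k : ℝ) x y =
        largeZPrefactor p (k : ℝ) x y *
          ∑ n ∈ Finset.range k, largeZTerm p (k : ℝ) x y n) := by
  refine ⟨fun R ε δ _ hε hδ N => ?_, fun p x y k hp hk hx hy0 hy1 =>
    ⟨fun n => largeZTerm_natCast_eq_zero hk, noncentralBetaCDF_natCast hp hk hx hy0 hy1⟩⟩
  obtain ⟨C, hC, hbound⟩ := exists_abs_noncentralBetaCDF_sub_expansion_le R hε hδ N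
  exact ⟨C, 1, hC, one_pos, hbound⟩
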